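/- Let $d$ be the metric on $\mathbb{R}^n$ induced by some norm, let $w_1,\dots,w_N:\mathbb{R}^n\to\mathbb{R}^n$ be contractions with respect to $d$, and let $p_1,\dots,p_N>0$ with $\sum_{i} p_i=1$ (a hyperbolic iterated function system with constant probabilities). Let $\pi_\infty$ be its invariant measure, i.e. the Borel probability measure on $\mathbb{R}^n$ with $\pi_\infty=\sum_i p_i\,\pi_\infty\circ w_i^{-1}$. For $\delta>0$ let $\mathcal{D}^n(\delta)=\{\delta m: m\in\mathbb{Z}^n\}$. The $\delta$-roundoff $\tilde x\in\mathcal{D}^n(\delta)$ of $x\in\mathbb{R}^n$ is $\delta m$, where $m\in\mathbb{Z}^n$ is the unique index with $x\in\prod_{j=1}^n[(m_j-\frac12)\delta,(m_j+\frac12)\delta)$, and the $\delta$-roundoff of $w_i$ is $\tilde w_i:\mathcal{D}^n(\delta)\to\mathcal{D}^n(\delta)$, $\tilde w_i(x)=\widetilde{w_i(x)}$. Consider the Markov chain on $\mathcal{D}^n(\delta)$ with transition probabilities $P(x,y)=\sum_{i=1}^N p_i\mathbf{1}_{\{y\}}(\tilde w_i(x))$, and let $\Pi(\delta)$ be the family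 of all stationary distributions of this chain whose support is a positive recurrent class (a closed communication class consisting of positive recurrent states). Let $\pi(\delta)$ be any element of $\Pi(\delta)$, for each $\delta>0$. Then for every bounded continuous $f:\mathbb{R}^n\to\mathbb{R}$, $$\lim_{\delta\to0^+}\ \sum_{x\in\mathcal{D}^n(\delta)}f(x)\,\pi(\delta)\{x\}=\int_{\mathbb{R}^n}f\,d\pi_\infty,$$ that is, $\pi(\delta)$ converges weakly to $\pi_\infty$ as $\delta\to0^+$. For each fixed $f$ this holds whatever the choice of $\pi(\delta)$: for every $\varepsilon>0$ there is $\delta_0>0$ such that for all $\delta\in(0,\delta_0)$ and all $\pi\in\Pi(\delta)$, $\bigl|\sum_{x\in\mathcal{D}^n(\delta)}f(x)\,\pi\{x\}-\int_{\mathbb{R}^n}f\,d\pi_\infty\bigr|<\varepsilon$. -/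

import Mathlib

open MeasureTheory Filter Topology
open scoped NNReal ENNReal BoundedContinuousFunction

noncomputable section

/-! ### The grid and rounding -/

/-- The half-open cube of side `δ` centred at `δ m`. -/
def cube {n : ℕ} (δ : ℝ) (m : Fin n → ℤ) : Set (Fin n → ℝ) :=
  {x | ∀ j, ((m j : ℝ) - 1 / 2) * δ ≤ x j ∧ x j < ((m j : ℝ) + 1 / 2) * δ}

/-- The grid point `δ m`, the centre of the cube with index `m`. -/
def gridPoint {n : ℕ} (δ : ℝ) (m : Fin n → ℤ) : Fin n → ℝ := fun j => δ * (m j : ℝ)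

/-- The discretization of `ℝⁿ`: the set of all centres of the cubes of side `δ`. -/
def grid (n : ℕ) (δ : ℝ) : Set (Fin n → ℝ) := Set.range (gridPoint (n := n) δ)

/-- The index of the cube of side `δ` in which `x` lies (see `mem_cube_iff`). -/
def cubeIndex {n : ℕ} (δ : ℝ) (x : Fin n → ℝ) : Fin n → ℤ := fun j => ⌊x j / δ + 1 / 2⌋

theorem mem_cube_iff {n : ℕ} {δ : ℝ} (hδ : 0 < δ) (x : Fin n → ℝ) (m : Fin n → ℤ) :
    x ∈ cube δ m ↔ m = cubeIndex δ x := by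
  have key : ∀ j, (((m j : ℝ) - 1 / 2) * δ ≤ x j ∧ x j < ((m j : ℝ) + 1 / 2) * δ) ↔
      m j = cubeIndex δ x j := by
    intro j
    rw [cubeIndex, eq_comm, Int.floor_eq_iff, ← le_div_iff₀ hδ, ← div_lt_iff₀ hδ]
    constructor <;> rintro ⟨h1, h2⟩ <;> constructor <;> linarith
  simp only [cube, Set.mem_ofPred_eq, key, funext_iff]

/-- The `δ`-roundoff of a point: the centre of the cube in which it lies. -/
def roundoff {n : ℕ} (δ : ℝ) (x : Fin n → ℝ) : grid n δ :=
  ⟨gridPoint δ (cubeIndex δ x), Set.mem_range_self _⟩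

/-- The `δ`-roundoff of a mapping of `ℝⁿ`, as a self-map of the grid. -/
def roundoffMap {n : ℕ} (δ : ℝ) (w : (Fin n → ℝ) → (Fin n → ℝ)) (x : grid n δ) : grid n δ :=
  roundoff δ (w x)

/-! ### Markov chains on a discrete state space

Here `P x y` is the probability of moving from `x` to `y` in one step. -/

section Markov

variable {S : Type*}

/-- The `k`-step transition probabilities, i.e. the entries of the `k`-th power of `P`. -/
def stepProb (P : S → S → ℝ≥0∞) : ℕ → S → S → ℝ≥0∞
  | 0, x, y => Set.indicator {y} 1 x
  | k + 1, x, y => ∑' z, P x z * stepProb P k z y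

/-- `y` is accessible from `x`. -/
def Accessible (P : S → S → ℝ≥0∞) (x y : S) : Prop := ∃ k, 0 < stepProb P k x y

/-- A communication class: a maximal set of states that are accessible from each other. -/
def IsCommunicationClass (P : S → S → ℝ≥0∞) (C : Set S) : Prop :=
  Maximal (fun C : Set S => ∀ x ∈ C, ∀ y ∈ C, Accessible P x y) C

/-- A closed class: only states of `C` are accessible from `C`. -/
def IsClosedClass (P : S → S → ℝ≥0∞) (C : Set S) : Prop :=
  ∀ x ∈ C, ∀ y, Accessible P x y → y ∈ C

/-- `firstPassage P k x y` is the probability that the chain started at `x` visits `y` at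
time `k` and at none of the times `1, …, k - 1`. -/
def firstPassage (P : S → S → ℝ≥0∞) : ℕ → S → S → ℝ≥0∞
  | 0, _, _ => 0
  | 1, x, y => P x y
  | k + 2, x, y => ∑' z : {z : S // z ≠ y}, P x z * firstPassage P (k + 1) z y

/-- A state to which the chain returns with probability `1` in finitely many steps. -/
def IsRecurrentState (P : S → S → ℝ≥0∞) (x : S) : Prop :=
  ∑' k, firstPassage P k x x = 1

/-- A recurrent state whose expected number of steps to return is finite. -/
def IsPositiveRecurrentState (P : S → S → ℝ≥0∞) (x : S) : Prop :=
  IsRecurrentState P x ∧ ∑' k : ℕ, (k : ℝ≥0∞) * firstPassage P k x x < ∞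

/-- A closed communication class that consists of positive recurrent states. -/
def IsPositiveRecurrentClass (P : S → S → ℝ≥0∞) (C : Set S) : Prop :=
  IsCommunicationClass P C ∧ IsClosedClass P C ∧ ∀ x ∈ C, IsPositiveRecurrentState P x

/-- A stationary distribution: a probability distribution `π` with `π P = π`. -/
def IsStationaryDistribution (P : S → S → ℝ≥0∞) (π : PMF S) : Prop :=
  ∀ y, ∑' x, π x * P x y = π y

end Markov

/-! ### Iterated function systems -/

/-- A discrete iterated function system with place-dependent probabilities on the
(discrete) space `S`. -/
structure DIFS (S : Type*) (N : ℕ) where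
  map : Fin N → S → S
  prob : Fin N → S → ℝ≥0
  prob_pos : ∀ i x, 0 < prob i x
  prob_sum : ∀ x, ∑ i, prob i x = 1

/-- The transition matrix of the Markov chain of a discrete iterated function system. -/
def DIFS.transition {S : Type*} {N : ℕ} (D : DIFS S N) (x y : S) : ℝ≥0∞ :=
  ∑ i, (D.prob i x : ℝ≥0∞) * Set.indicator {y} 1 (D.map i x)

/-- The family of the stationary distributions whose support is a positive recurrent class. -/
def DIFS.classStationary {S : Type*} {N : ℕ} (D : DIFS S N) : Set (PMF S) :=
  {π | IsStationaryDistribution D.transition π ∧ IsPositiveRecurrentClass D.transition π.support}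

/-- A hyperbolic iterated function system with constant probabilities on `ℝⁿ`: finitely many
contractions with respect to (the metric induced by) an arbitrary norm, chosen with positive
probabilities. The ambient topology and Borel sets of `Fin n → ℝ` are those of any norm. -/
structure HyperbolicIFS (n N : ℕ) where
  norm : Seminorm ℝ (Fin n → ℝ)
  norm_definite : ∀ x, norm x = 0 → x = 0
  map : Fin N → (Fin n → ℝ) → (Fin n → ℝ)
  contracting : ∀ i, ∃ r : ℝ, 0 ≤ r ∧ r < 1 ∧
    ∀ x y, norm (map i x - map i y) ≤ r * norm (x - y)
  prob : Fin N → ℝ≥0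
  prob_pos : ∀ i, 0 < prob i
  prob_sum : ∑ i, prob i = 1

/-- An invariant measure: a Borel probability measure fixed by the Markov operator
`μ ↦ ∑ i, p i • (μ ∘ (w i)⁻¹)`. -/
def HyperbolicIFS.IsInvariantMeasure {n N : ℕ} (F : HyperbolicIFS n N)
    (μ : ProbabilityMeasure (Fin n → ℝ)) : Prop :=
  ∑ i, F.prob i • (μ : Measure (Fin n → ℝ)).map (F.map i) = (μ : Measure (Fin n → ℝ))

/-- The discrete system on the `δ`-grid formed by the `δ`-roundoffs of the maps of `F`, with the
same constant probabilities. -/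
def HyperbolicIFS.discretize {n N : ℕ} (F : HyperbolicIFS n N) (δ : ℝ) : DIFS (grid n δ) N where
  map i := roundoffMap δ (F.map i)
  prob i _ := F.prob i
  prob_pos i _ := F.prob_pos i
  prob_sum _ := F.prob_sum

/-- A distribution on the `δ`-grid, viewed as a Borel probability measure on `ℝⁿ`. -/
def gridMeasure {n : ℕ} {δ : ℝ} (π : PMF (grid n δ)) : ProbabilityMeasure (Fin n → ℝ) :=
  ⟨(π.map Subtype.val).toMeasure, inferInstance⟩

end

/-!
Write `T g x = ∑ i, p i * g (w i x)` for the Markov operator of the system acting on functions,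
and let `d x y = F.norm (x - y)`. The proof compares integrals of a bounded `L`-Lipschitz function
`g` (Lipschitz with respect to `d`), using only that `π(δ)` is stationary.

* Rounding moves a point by at most `E = O(δ)`, so stationarity of `π(δ)` for the rounded system
  gives `|∫ g dπ(δ) - ∫ T g dπ(δ)| ≤ L * E`.
* `T` turns `L`-Lipschitz functions into `r * L`-Lipschitz ones, where `r < 1` is the average
  contraction factor. Summing a geometric series,
  `|∫ g dπ(δ) - ∫ T^k g dπ(δ)| ≤ L * E / (1 - r)` for all `k`
  (`HyperbolicIFS.abs_integral_sub_integral_iterate_le`).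
* The oscillation of `T^k g` between any two points tends to `0` as `k → ∞`, so by dominated
  convergence `∫ T^k g dπ(δ) - ∫ T^k g dπ_∞ → 0`, whereas `∫ T^k g dπ_∞ = ∫ g dπ_∞` for every `k`.

Hence `|∫ g dπ(δ) - ∫ g dπ_∞| ≤ L * E / (1 - r) = O(δ)`
(`HyperbolicIFS.abs_integral_sub_integral_le`), uniformly over all stationary distributions, and
bounded Lipschitz functions determine weak convergence. The uniformity in `π(δ)` for general
bounded continuous `f` is obtained by proving weak convergence along a filter on the pairs
`(δ, π)`.
-/

/-! ### Norms on `ℝⁿ` -/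

theorem Seminorm.continuous_of_pi {n : ℕ} (p : Seminorm ℝ (Fin n → ℝ)) : Continuous p :=
  p.convexOn.locallyLipschitz.continuous

/-- A definite seminorm on `ℝⁿ` dominates the supremum norm, by compactness of the unit sphere. -/
theorem Seminorm.exists_norm_le_of_definite {n : ℕ} (p : Seminorm ℝ (Fin n → ℝ))
    (hp : ∀ x, p x = 0 → x = 0) : ∃ K : ℝ, 0 ≤ K ∧ ∀ x, ‖x‖ ≤ K * p x := by
  rcases (Metric.sphere (0 : Fin n → ℝ) 1).eq_empty_or_nonempty with h | h
  · -- an empty unit sphere means that the space is trivial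
    refine ⟨0, le_rfl, fun x => ?_⟩
    by_contra hx
    have hx' : ‖x‖ ≠ 0 := fun h0 => hx (by simp [h0])
    have : ‖x‖⁻¹ • x ∈ Metric.sphere (0 : Fin n → ℝ) 1 := by
      simp [norm_smul, inv_mul_cancel₀ hx']
    simp [h] at this
  · obtain ⟨z, hz, hmin⟩ := (isCompact_sphere (0 : Fin n → ℝ) 1).exists_isMinOn h
      p.continuous_of_pi.continuousOn
    have hz1 : ‖z‖ = 1 := by simpa using hz
    have hpz : 0 < p z := lt_of_le_of_ne (apply_nonneg p z) fun h0 => by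
      simp [hp z h0.symm] at hz1
    refine ⟨(p z)⁻¹, by positivity, fun x => ?_⟩
    by_cases hx : ‖x‖ = 0
    · rw [hx]; exact mul_nonneg (by positivity) (apply_nonneg p x)
    have hx0 : 0 < ‖x‖ := lt_of_le_of_ne (norm_nonneg x) (Ne.symm hx)
    have hmem : ‖x‖⁻¹ • x ∈ Metric.sphere (0 : Fin n → ℝ) 1 := by
      simp [norm_smul, inv_mul_cancel₀ hx]
    have h1 : p z ≤ p (‖x‖⁻¹ • x) := hmin hmem
    rw [map_smul_eq_mul, norm_inv, norm_norm, inv_mul_eq_div, le_div_iff₀ hx0] at h1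
    rwa [inv_mul_eq_div, le_div_iff₀ hpz, mul_comm]

/-! ### Rounding -/

theorem norm_roundoff_sub_le {n : ℕ} {δ : ℝ} (hδ : 0 < δ) (x : Fin n → ℝ) :
    ‖(roundoff δ x : Fin n → ℝ) - x‖ ≤ δ / 2 := by
  refine (pi_norm_le_iff_of_nonneg (by positivity)).2 fun j => ?_
  obtain ⟨h1, h2⟩ := (mem_cube_iff hδ x (cubeIndex δ x)).2 rfl j
  have : (roundoff δ x : Fin n → ℝ) j = δ * (cubeIndex δ x j : ℝ) := rfl
  rw [Pi.sub_apply, this, Real.norm_eq_abs, abs_le]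
  constructor <;> linarith

instance grid_countable (n : ℕ) (δ : ℝ) : Countable (grid n δ) :=
  (Set.countable_range _).to_subtype

/-! ### Integrals with respect to stationary measures -/

theorem integrable_of_abs_le {X : Type*} [MeasurableSpace X] (μ : Measure X) [IsFiniteMeasure μ]
    {g : X → ℝ} {M : ℝ} (hg : Measurable g) (hM : ∀ x, |g x| ≤ M) : Integrable g μ :=
  .of_bound hg.aestronglyMeasurable M (.of_forall hM)

theorem integral_eq_integral_sum_of_sum_map_eq {X ι : Type*} [MeasurableSpace X] [Fintype ι]
    {μ : Measure X} [IsFiniteMeasure μ] {p : ι → ℝ≥0} {φ : ι → X → X}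
    (hφ : ∀ i, Measurable (φ i)) (hμ : ∑ i, p i • μ.map (φ i) = μ)
    {g : X → ℝ} {M : ℝ} (hg : Measurable g) (hM : ∀ x, |g x| ≤ M) :
    ∫ x, g x ∂μ = ∫ x, ∑ i, (p i : ℝ) * g (φ i x) ∂μ := by
  conv_lhs => rw [← hμ]
  rw [integral_finsetSum_measure, integral_finsetSum]
  · refine Finset.sum_congr rfl fun i _ => ?_
    rw [integral_smul_nnreal_measure, integral_map (hφ i).aemeasurable hg.aestronglyMeasurable,
      integral_const_mul, NNReal.smul_def, smul_eq_mul]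
  · exact fun i _ => (integrable_of_abs_le μ (hg.comp (hφ i)) fun x => hM _).const_mul _
  · exact fun i _ => integrable_of_abs_le _ hg hM

/-- On a countable discrete space, stationarity of a distribution under the transition matrix of
a system with constant probabilities is invariance of the associated measure. -/
theorem sum_map_toMeasure_eq_of_isStationaryDistribution {S : Type*} {N : ℕ} [MeasurableSpace S]
    [Countable S] [MeasurableSingletonClass S] {D : DIFS S N} {p : Fin N → ℝ≥0}
    (hp : ∀ i x, D.prob i x = p i) {π : PMF S} (hπ : IsStationaryDistribution D.transition π) :
    ∑ i, p i • π.toMeasure.map (D.map i) = π.toMeasure := by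
  refine Measure.ext_of_singleton fun y => ?_
  rw [PMF.toMeasure_apply_singleton _ _ (measurableSet_singleton y), ← hπ y]
  simp only [DIFS.transition, hp, Finset.mul_sum]
  rw [Summable.tsum_finsetSum fun _ _ => ENNReal.summable, Measure.finsetSum_apply]
  refine Finset.sum_congr rfl fun i _ => ?_
  rw [Measure.smul_apply, Measure.map_apply (by fun_prop) (measurableSet_singleton y),
    PMF.toMeasure_apply_eq_tsum, ENNReal.smul_def, smul_eq_mul, ← ENNReal.tsum_mul_left]
  refine tsum_congr fun x => ?_
  by_cases h : D.map i x = y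
  · simp [h, mul_comm]
  · simp [h]

theorem integral_gridMeasure {n : ℕ} {δ : ℝ} (π : PMF (grid n δ)) {f : (Fin n → ℝ) → ℝ}
    (hf : Measurable f) :
    ∫ x, f x ∂(gridMeasure π : Measure (Fin n → ℝ)) = ∫ x : grid n δ, f x ∂π.toMeasure := by
  change ∫ x, f x ∂(π.map Subtype.val).toMeasure = _
  have hmap := PMF.toMeasure_map (f := fun x : grid n δ => (x : Fin n → ℝ)) π
    measurable_subtype_coe
  rw [← hmap, integral_map measurable_subtype_coe.aemeasurable hf.aestronglyMeasurable]

theorem tsum_eq_integral_gridMeasure {n : ℕ} {δ : ℝ} (π : PMF (grid n δ))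
    (f : (Fin n → ℝ) →ᵇ ℝ) :
    ∑' x : grid n δ, f x * (π x).toReal = ∫ x, f x ∂(gridMeasure π : Measure (Fin n → ℝ)) := by
  have hf : Measurable f := f.continuous.measurable
  rw [integral_gridMeasure π hf, PMF.integral_eq_tsum]
  · simp only [smul_eq_mul, mul_comm]
  · exact integrable_of_abs_le (M := ‖f‖) _ (hf.comp measurable_subtype_coe)
      fun x => f.norm_coe_le_norm x

namespace HyperbolicIFS

variable {n N : ℕ} (F : HyperbolicIFS n N)

/-! ### The Markov operator on functions -/

/-- `g` is `L`-Lipschitz with respect to the metric induced by the norm of the system. -/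
def IsLip (L : ℝ) (g : (Fin n → ℝ) → ℝ) : Prop := ∀ x y, |g x - g y| ≤ L * F.norm (x - y)

/-- The Markov operator of the system acting on functions: the expectation of `g` after one
random step from `x`. -/
def op (g : (Fin n → ℝ) → ℝ) (x : Fin n → ℝ) : ℝ := ∑ i, (F.prob i : ℝ) * g (F.map i x)

theorem sum_prob_coe : ∑ i, (F.prob i : ℝ) = 1 := by exact_mod_cast F.prob_sum

variable {F} in
theorem IsLip.continuous {L : ℝ} {g : (Fin n → ℝ) → ℝ} (hg : F.IsLip L g) : Continuous g := by
  refine continuous_iff_continuousAt.2 fun x => ?_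
  refine tendsto_iff_dist_tendsto_zero.2 (squeeze_zero (fun _ => dist_nonneg)
    (fun y => (Real.dist_eq _ _).trans_le (hg y x)) ?_)
  have : Continuous fun y => L * F.norm (y - x) :=
    continuous_const.mul (F.norm.continuous_of_pi.comp (by fun_prop))
  simpa using this.tendsto x

theorem continuous_map (i : Fin N) : Continuous (F.map i) := by
  obtain ⟨K, -, hK⟩ := F.norm.exists_norm_le_of_definite F.norm_definite
  obtain ⟨r, -, hr, h⟩ := F.contracting i
  refine continuous_iff_continuousAt.2 fun x => ?_
  refine tendsto_iff_dist_tendsto_zero.2 (squeeze_zero (g := fun y => |K| * (|r| * F.norm (y - x)))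
    (fun _ => dist_nonneg) (fun y => ?_) ?_)
  · rw [dist_eq_norm]
    refine (hK _).trans (mul_le_mul (le_abs_self K) ((h y x).trans ?_) (apply_nonneg _ _)
      (abs_nonneg K))
    exact mul_le_mul_of_nonneg_right (le_abs_self r) (apply_nonneg _ _)
  · have : Continuous fun y => |K| * (|r| * F.norm (y - x)) :=
      continuous_const.mul (continuous_const.mul (F.norm.continuous_of_pi.comp (by fun_prop)))
    simpa using this.tendsto x

/-- The Markov operator contracts Lipschitz constants; the factor is the average of the
contraction factors of the maps. -/
theorem exists_isLip_op : ∃ r : ℝ, 0 ≤ r ∧ r < 1 ∧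
    ∀ (L : ℝ) (g : (Fin n → ℝ) → ℝ), 0 ≤ L → F.IsLip L g → F.IsLip (r * L) (F.op g) := by
  choose r hr0 hr1 hr using F.contracting
  have hN : (Finset.univ : Finset (Fin N)).Nonempty := by
    by_contra h
    have := F.prob_sum
    simp [Finset.not_nonempty_iff_eq_empty.1 h] at this
  refine ⟨∑ i, (F.prob i : ℝ) * r i, Finset.sum_nonneg fun i _ => mul_nonneg (F.prob i).2 (hr0 i),
    ?_, fun L g hL hg x y => ?_⟩
  · rw [← F.sum_prob_coe]
    exact Finset.sum_lt_sum_of_nonempty hN fun i _ =>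
      mul_lt_of_lt_one_right (NNReal.coe_pos.2 (F.prob_pos i)) (hr1 i)
  · rw [op, op, ← Finset.sum_sub_distrib, Finset.sum_mul, Finset.sum_mul]
    refine (Finset.abs_sum_le_sum_abs _ _).trans (Finset.sum_le_sum fun i _ => ?_)
    rw [← mul_sub, abs_mul, NNReal.abs_eq, mul_assoc, mul_assoc]
    refine mul_le_mul_of_nonneg_left ?_ (F.prob i).2
    calc |g (F.map i x) - g (F.map i y)| ≤ L * F.norm (F.map i x - F.map i y) := hg _ _
      _ ≤ L * (r i * F.norm (x - y)) := mul_le_mul_of_nonneg_left (hr i x y) hL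
      _ = r i * (L * F.norm (x - y)) := by ring

theorem abs_op_le {g : (Fin n → ℝ) → ℝ} {M : ℝ} (hM : ∀ x, |g x| ≤ M) (x : Fin n → ℝ) :
    |F.op g x| ≤ M := by
  calc |F.op g x| ≤ ∑ i, |(F.prob i : ℝ) * g (F.map i x)| := Finset.abs_sum_le_sum_abs _ _
    _ ≤ ∑ i, (F.prob i : ℝ) * M := Finset.sum_le_sum fun i _ => by
        rw [abs_mul, NNReal.abs_eq]
        exact mul_le_mul_of_nonneg_left (hM _) (F.prob i).2
    _ = M := by rw [← Finset.sum_mul, F.sum_prob_coe, one_mul]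

theorem abs_op_iterate_le {g : (Fin n → ℝ) → ℝ} {M : ℝ} (hM : ∀ x, |g x| ≤ M) (k : ℕ) :
    ∀ x, |F.op^[k] g x| ≤ M := by
  induction k with
  | zero => exact hM
  | succ k ih => rw [Function.iterate_succ_apply']; exact F.abs_op_le ih

variable {F} in
theorem IsLip.op_iterate {r : ℝ} (hr0 : 0 ≤ r)
    (hr : ∀ (L : ℝ) (g : (Fin n → ℝ) → ℝ), 0 ≤ L → F.IsLip L g → F.IsLip (r * L) (F.op g))
    {L : ℝ} (hL : 0 ≤ L) {g : (Fin n → ℝ) → ℝ} (hg : F.IsLip L g) (k : ℕ) :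
    F.IsLip (r ^ k * L) (F.op^[k] g) := by
  induction k with
  | zero => simpa using hg
  | succ k ih =>
    rw [Function.iterate_succ_apply', pow_succ', mul_assoc]
    exact hr _ _ (by positivity) ih

/-! ### Comparison of the invariant measures -/

/-- The effect of one step of the Markov operator on integrals against a stationary distribution
of the rounded system: the error is the one made by rounding. -/
theorem abs_integral_sub_integral_op_le {δ : ℝ} {π : PMF (grid n δ)}
    (hπ : IsStationaryDistribution (F.discretize δ).transition π) {E : ℝ}
    (hE : ∀ x : Fin n → ℝ, F.norm (roundoff δ x - x) ≤ E) {g : (Fin n → ℝ) → ℝ} {L M : ℝ}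
    (hL : 0 ≤ L) (hg : F.IsLip L g) (hM : ∀ x, |g x| ≤ M) :
    |∫ x : grid n δ, g x ∂π.toMeasure - ∫ x : grid n δ, F.op g x ∂π.toMeasure| ≤ L * E := by
  rw [integral_eq_integral_sum_of_sum_map_eq (p := F.prob) (φ := (F.discretize δ).map)
    (g := fun x : grid n δ => g x) (fun _ => by fun_prop)
    (sum_map_toMeasure_eq_of_isStationaryDistribution (fun _ _ => rfl) hπ)
    .of_discrete (fun x => hM x)]
  rw [← integral_sub]
  · rw [← Real.norm_eq_abs]
    refine (norm_integral_le_of_norm_le_const (μ := π.toMeasure) (C := L * E)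
      (.of_forall fun x => ?_)).trans
      (le_of_eq (by rw [probReal_univ, mul_one] : L * E * π.toMeasure.real Set.univ = L * E))
    rw [op, ← Finset.sum_sub_distrib, Real.norm_eq_abs]
    calc _ ≤ ∑ i, |(F.prob i : ℝ) * g ((F.discretize δ).map i x)
            - (F.prob i : ℝ) * g (F.map i x)| := Finset.abs_sum_le_sum_abs _ _
      _ ≤ ∑ i, (F.prob i : ℝ) * (L * E) := Finset.sum_le_sum fun i _ => by
          rw [← mul_sub, abs_mul, NNReal.abs_eq]
          exact mul_le_mul_of_nonneg_left
            ((hg _ _).trans (mul_le_mul_of_nonneg_left (hE _) hL)) (F.prob i).2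
      _ = L * E := by rw [← Finset.sum_mul, F.sum_prob_coe, one_mul]
  · exact integrable_finsetSum _ fun i _ =>
      (integrable_of_abs_le _ .of_discrete fun x => hM _).const_mul _
  · exact integrable_of_abs_le _ .of_discrete fun x => F.abs_op_le hM x

/-- The errors made in `k` steps add up to at most a geometric series, because the Lipschitz
constant shrinks by the factor `r` in each step. -/
theorem abs_integral_sub_integral_iterate_le {δ : ℝ} {π : PMF (grid n δ)}
    (hπ : IsStationaryDistribution (F.discretize δ).transition π) {E : ℝ}
    (hE : ∀ x : Fin n → ℝ, F.norm (roundoff δ x - x) ≤ E) {r : ℝ} (hr0 : 0 ≤ r) (hr1 : r < 1)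
    (hr : ∀ (L : ℝ) (g : (Fin n → ℝ) → ℝ), 0 ≤ L → F.IsLip L g → F.IsLip (r * L) (F.op g))
    {M : ℝ} (k : ℕ) : ∀ {g : (Fin n → ℝ) → ℝ} {L : ℝ}, 0 ≤ L → F.IsLip L g →
    (∀ x, |g x| ≤ M) →
    |∫ x : grid n δ, g x ∂π.toMeasure - ∫ x : grid n δ, F.op^[k] g x ∂π.toMeasure|
      ≤ L * E / (1 - r) := by
  have hr' : 0 < 1 - r := sub_pos.2 hr1
  have hE0 : 0 ≤ E := (apply_nonneg _ _).trans (hE 0)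
  induction k with
  | zero =>
    intro g L hL _ _
    simp only [Function.iterate_zero, id, sub_self, abs_zero]
    positivity
  | succ k ih =>
    intro g L hL hg hM
    rw [Function.iterate_succ_apply]
    calc _ ≤ _ := abs_sub_le _ (∫ x : grid n δ, F.op g x ∂π.toMeasure) _
      _ ≤ L * E + r * L * E / (1 - r) := add_le_add
          (F.abs_integral_sub_integral_op_le hπ hE hL hg hM)
          (ih (mul_nonneg hr0 hL) (hr _ _ hL hg) (F.abs_op_le hM))
      _ = L * E / (1 - r) := by field_simp; ring

/-- The iterates of `g` become constant in the limit, for any law on `ℝⁿ`: their mean under the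
law of `φ` approaches their value at the origin. -/
theorem tendsto_integral_op_iterate_sub {X : Type*} [MeasurableSpace X] (μ : Measure X)
    [IsProbabilityMeasure μ] {φ : X → Fin n → ℝ} (hφ : Measurable φ) {r : ℝ} (hr0 : 0 ≤ r)
    (hr1 : r < 1)
    (hr : ∀ (L : ℝ) (g : (Fin n → ℝ) → ℝ), 0 ≤ L → F.IsLip L g → F.IsLip (r * L) (F.op g))
    {g : (Fin n → ℝ) → ℝ} {L M : ℝ} (hL : 0 ≤ L) (hg : F.IsLip L g) (hM : ∀ x, |g x| ≤ M) :
    Tendsto (fun k : ℕ => ∫ x, F.op^[k] g (φ x) ∂μ - F.op^[k] g 0) atTop (𝓝 0) := by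
  have hlip := fun k => hg.op_iterate hr0 hr hL k
  have hmeas : ∀ k, Measurable fun x => F.op^[k] g (φ x) :=
    fun k => (hlip k).continuous.measurable.comp hφ
  have hbd := fun k => F.abs_op_iterate_le hM k
  have heq : ∀ k : ℕ, ∫ x, F.op^[k] g (φ x) ∂μ - F.op^[k] g 0
      = ∫ x, (F.op^[k] g (φ x) - F.op^[k] g 0) ∂μ := fun k => by
    rw [integral_sub (integrable_of_abs_le μ (hmeas k) fun x => hbd k _) (integrable_const _)]
    simp
  simp only [heq]
  rw [← integral_zero X ℝ (μ := μ)]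
  refine tendsto_integral_of_dominated_convergence (fun _ => M + M)
    (fun k => ((hmeas k).sub_const _).aestronglyMeasurable) (integrable_const _)
    (fun k => .of_forall fun x => (abs_sub _ _).trans (add_le_add (hbd k _) (hbd k _)))
    (.of_forall fun x => ?_)
  refine squeeze_zero_norm (fun k => hlip k (φ x) 0) ?_
  have := ((tendsto_pow_atTop_nhds_zero_of_lt_one hr0 hr1).mul_const L).mul_const
    (F.norm (φ x - 0))
  simpa using this

theorem integral_op_iterate_eq {μ : ProbabilityMeasure (Fin n → ℝ)} (hμ : F.IsInvariantMeasure μ)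
    {r : ℝ} (hr0 : 0 ≤ r)
    (hr : ∀ (L : ℝ) (g : (Fin n → ℝ) → ℝ), 0 ≤ L → F.IsLip L g → F.IsLip (r * L) (F.op g))
    {g : (Fin n → ℝ) → ℝ} {L M : ℝ} (hL : 0 ≤ L) (hg : F.IsLip L g) (hM : ∀ x, |g x| ≤ M)
    (k : ℕ) :
    ∫ x, F.op^[k] g x ∂(μ : Measure (Fin n → ℝ)) = ∫ x, g x ∂(μ : Measure (Fin n → ℝ)) := by
  induction k with
  | zero => rfl
  | succ k ih =>
    rw [← ih, Function.iterate_succ_apply', integral_eq_integral_sum_of_sum_map_eq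
      (fun i => (F.continuous_map i).measurable) hμ
      (hg.op_iterate hr0 hr hL k).continuous.measurable (F.abs_op_iterate_le hM k)]
    rfl

/-- The quantitative form of the convergence: integrals of a Lipschitz function against a
stationary distribution of the rounded system and against the invariant measure differ by at most
a multiple of the rounding error `E`. -/
theorem abs_integral_sub_integral_le {δ : ℝ} {π : PMF (grid n δ)}
    (hπ : IsStationaryDistribution (F.discretize δ).transition π)
    {μ : ProbabilityMeasure (Fin n → ℝ)} (hμ : F.IsInvariantMeasure μ) {E : ℝ}
    (hE : ∀ x : Fin n → ℝ, F.norm (roundoff δ x - x) ≤ E) {r : ℝ} (hr0 : 0 ≤ r) (hr1 : r < 1)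
    (hr : ∀ (L : ℝ) (g : (Fin n → ℝ) → ℝ), 0 ≤ L → F.IsLip L g → F.IsLip (r * L) (F.op g))
    {g : (Fin n → ℝ) → ℝ} {L M : ℝ} (hL : 0 ≤ L) (hg : F.IsLip L g) (hM : ∀ x, |g x| ≤ M) :
    |∫ x, g x ∂(gridMeasure π : Measure (Fin n → ℝ)) - ∫ x, g x ∂(μ : Measure (Fin n → ℝ))|
      ≤ L * E / (1 - r) := by
  rw [integral_gridMeasure π hg.continuous.measurable]
  have h1 := F.tendsto_integral_op_iterate_sub π.toMeasure measurable_subtype_coe hr0 hr1 hr hL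
    hg hM
  have h2 := F.tendsto_integral_op_iterate_sub (μ : Measure (Fin n → ℝ)) measurable_id hr0 hr1 hr
    hL hg hM
  -- the common value at the origin cancels, and the integrals against `μ` do not depend on `k`
  have h3 := h1.sub h2
  simp only [id, F.integral_op_iterate_eq hμ hr0 hr hL hg hM, sub_sub_sub_cancel_right,
    sub_zero] at h3
  have h5 := ((tendsto_const_nhds (x := ∫ x : grid n δ, g x ∂π.toMeasure
    - ∫ x, g x ∂(μ : Measure (Fin n → ℝ)))).sub h3).abs
  rw [sub_zero] at h5
  refine le_of_tendsto h5 (.of_forall fun k => ?_)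
  rw [sub_sub_sub_cancel_right]
  exact F.abs_integral_sub_integral_iterate_le hπ hE hr0 hr1 hr k hL hg hM

/-! ### Weak convergence -/

/-- The filter `δ → 0⁺` on the pairs of a `δ > 0` and a distribution in the family belonging to
`δ`; convergence along it is convergence uniform over the family. -/
def classFilter : Filter (Σ δ : ℝ, PMF (grid n δ)) :=
  comap Sigma.fst (𝓝[>] (0 : ℝ)) ⊓ 𝓟 {s | s.2 ∈ (F.discretize s.1).classStationary}

theorem tendsto_gridMeasure_classFilter {μ : ProbabilityMeasure (Fin n → ℝ)}
    (hμ : F.IsInvariantMeasure μ) :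
    Tendsto (fun s : Σ δ : ℝ, PMF (grid n δ) => gridMeasure s.2) F.classFilter (𝓝 μ) := by
  have : F.classFilter.IsCountablyGenerated := by unfold classFilter; infer_instance
  rw [tendsto_iff_forall_lipschitz_integral_tendsto]
  rintro f ⟨B, hB⟩ ⟨L, hL⟩
  -- `K` turns Lipschitz constants for the supremum metric into ones for the metric of the system,
  -- and `C` bounds the rounding error of at most `δ / 2` in each coordinate by `C * (δ / 2)`
  obtain ⟨K, hK0, hK⟩ := F.norm.exists_norm_le_of_definite F.norm_definite
  obtain ⟨C, hC0, hC⟩ := F.norm.bound_of_continuous_normedSpace F.norm.continuous_of_pi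
  obtain ⟨r, hr0, hr1, hr⟩ := F.exists_isLip_op
  have hg : F.IsLip (L * K) f := fun x y => by
    rw [mul_assoc, ← Real.dist_eq]
    refine (hL.dist_le_mul x y).trans (mul_le_mul_of_nonneg_left ?_ L.2)
    rw [dist_eq_norm]
    exact hK _
  have hM : ∀ x, |f x| ≤ |f 0| + B := fun x => by
    have h := hB x 0
    rw [Real.dist_eq] at h
    linarith [abs_sub_abs_le_abs_sub (f x) (f 0)]
  have hlim : Tendsto (fun s : Σ δ : ℝ, PMF (grid n δ) => L * K * (C * (s.1 / 2)) / (1 - r))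
      F.classFilter (𝓝 0) := by
    have h : Tendsto (fun δ : ℝ => L * K * (C * (δ / 2)) / (1 - r)) (𝓝[>] 0) (𝓝 0) := by
      have h2 : Tendsto (fun δ : ℝ => δ / 2) (𝓝[>] 0) (𝓝 (0 / 2)) :=
        (tendsto_id.mono_left nhdsWithin_le_nhds).div_const 2
      have h3 := ((h2.const_mul C).const_mul (L * K : ℝ)).div_const (1 - r)
      rwa [zero_div, mul_zero, mul_zero, zero_div] at h3
    exact h.comp (tendsto_comap.mono_left inf_le_left)
  refine tendsto_iff_dist_tendsto_zero.2 (squeeze_zero' (.of_forall fun _ => dist_nonneg) ?_ hlim)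
  have hpos : ∀ᶠ s in F.classFilter, s.1 ∈ Set.Ioi (0 : ℝ) :=
    (tendsto_comap.mono_left inf_le_left : Tendsto Sigma.fst F.classFilter _).eventually
      self_mem_nhdsWithin
  have hmem : ∀ᶠ s in F.classFilter, s.2 ∈ (F.discretize s.1).classStationary :=
    mem_inf_of_right (mem_principal_self _)
  filter_upwards [hpos, hmem] with s hs hsm
  rw [Real.dist_eq]
  exact F.abs_integral_sub_integral_le hsm.1 hμ
    (fun x => (hC _).trans (mul_le_mul_of_nonneg_left (norm_roundoff_sub_le hs x) hC0.le))
    hr0 hr1 hr (by positivity) hg hM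

end HyperbolicIFS

theorem mainTheorem1 {n N : ℕ} (F : HyperbolicIFS n N)
    (πinf : ProbabilityMeasure (Fin n → ℝ)) (hπinf : F.IsInvariantMeasure πinf) :
    -- the limit formula and weak convergence, for any choice of the distributions
    (∀ π : (∀ δ : ℝ, PMF (grid n δ)),
      (∀ δ : ℝ, 0 < δ → π δ ∈ (F.discretize δ).classStationary) →
        (∀ f : (Fin n → ℝ) →ᵇ ℝ,
          Tendsto (fun δ : ℝ => ∑' x : grid n δ, f x * (π δ x).toReal) (𝓝[>] 0)
            (𝓝 (∫ x, f x ∂(πinf : Measure (Fin n → ℝ))))) ∧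
        Tendsto (fun δ : ℝ => gridMeasure (π δ)) (𝓝[>] 0) (𝓝 πinf)) ∧
    -- the limit does not depend on the choice: it is uniform over the family for fixed `δ`
    (∀ f : (Fin n → ℝ) →ᵇ ℝ, ∀ ε : ℝ, 0 < ε → ∃ δ₀ : ℝ, 0 < δ₀ ∧
      ∀ δ : ℝ, 0 < δ → δ < δ₀ → ∀ π ∈ (F.discretize δ).classStationary,
        |∑' x : grid n δ, f x * (π x).toReal - ∫ x, f x ∂(πinf : Measure (Fin n → ℝ))| < ε) := by
  have key := F.tendsto_gridMeasure_classFilter hπinf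
  have keyf := ProbabilityMeasure.tendsto_iff_forall_integral_tendsto.1 key
  refine ⟨fun π hπ => ?_, fun f ε hε => ?_⟩
  · have hsec : Tendsto (fun δ : ℝ => (⟨δ, π δ⟩ : Σ δ : ℝ, PMF (grid n δ))) (𝓝[>] 0)
        F.classFilter := by
      refine tendsto_inf.2 ⟨tendsto_comap_iff.2 tendsto_id, tendsto_principal.2 ?_⟩
      filter_upwards [self_mem_nhdsWithin] with δ hδ using hπ δ hδ
    have hweak : Tendsto (fun δ : ℝ => gridMeasure (π δ)) (𝓝[>] 0) (𝓝 πinf) := by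
      have h := key.comp hsec
      rwa [Function.comp_def] at h
    refine ⟨fun f => ?_, hweak⟩
    simp only [tsum_eq_integral_gridMeasure]
    exact ProbabilityMeasure.tendsto_iff_forall_integral_tendsto.1 hweak f
  · have h := Metric.tendsto_nhds.1 (keyf f) ε hε
    rw [HyperbolicIFS.classFilter, eventually_inf_principal, eventually_comap] at h
    obtain ⟨δ₀, hδ₀, hsub⟩ := mem_nhdsGT_iff_exists_Ioo_subset.1 h
    refine ⟨δ₀, hδ₀, fun δ h0 h1 π hπ => ?_⟩
    rw [tsum_eq_integral_gridMeasure, ← Real.dist_eq]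
    exact hsub ⟨h0, h1⟩ ⟨δ, π⟩ rfl hπ
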